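/- For a simple graph $\Gamma$ let $A(\Gamma)=\langle V(\Gamma)\mid uvu^{-1}v^{-1}=1 \text{ whenever } \{u,v\}\in E(\Gamma)\rangle$ be its right-angled Artin group. A word in the letters $V(\Gamma)\cup V(\Gamma)^{-1}$ is reduced if no shorter word represents the same element of $A(\Gamma)$; the support $\mathrm{supp}(g)\subseteq V(\Gamma)$ of $g\in A(\Gamma)$ is the set of vertices $v$ such that $v$ or $v^{-1}$ occurs in a reduced word representing $g$ (it is well known that this does not depend on the reduced word). Let $P_n$ be the path graph on $n$ vertices and $P_n^c$ its complement. Let $n$ be a positive integer with $n\neq 3$, let $\Gamma$ be a finite simple graph, and let $\psi\colon A(P_n^c)\to A(\Gamma)$ be an injective homomorphism such that for every vertex $v$ of $P_n^c$ the set $\mathrm{supp}(\psi(v))$ consists of mutually adjacent vertices of $\Gamma$ (condition (KK)). Then there is a full embedding $\iota\colon P_n^c\to\Gamma$, that is, an injective map on vertices such that $u,v$ are adjacent in $P_n^c$ if and only if $\iota(u),\iota(v)$ are adjacent in $\Gamma$, with $\iota(v)\in\mathrm{supp}(\psi(v))$ for every vertex $v$ of $P_n^c$. In particular, $\iota(V(P_n^c))\subseteq\mathrm{supp}(\psi):=\bigcup_{v\in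 V(P_n^c)}\mathrm{supp}(\psi(v))$. -/

import Mathlib

/-- The defining relators of the right-angled Artin group on `Γ`: the commutators
`u * v * u⁻¹ * v⁻¹`, one for every (ordered) pair of adjacent vertices. -/
def raagRelators {V : Type*} (Γ : SimpleGraph V) : Set (FreeGroup V) :=
  {r | ∃ u v : V, Γ.Adj u v ∧
    r = FreeGroup.of u * FreeGroup.of v * (FreeGroup.of u)⁻¹ * (FreeGroup.of v)⁻¹}

/-- The right-angled Artin group `A(Γ)`: generated by the vertices of `Γ`, adjacent vertices
commute. -/
abbrev RAAG {V : Type*} (Γ : SimpleGraph V) : Type _ := PresentedGroup (raagRelators Γ)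

namespace RAAG

variable {V : Type*} (Γ : SimpleGraph V)

/-- The generator of `A(Γ)` given by a vertex. -/
def gen (v : V) : RAAG Γ := PresentedGroup.of v

/-- The element of `A(Γ)` represented by a word. A letter is a pair `(v, b)`, where `(v, true)`
stands for `v` and `(v, false)` stands for `v⁻¹`. -/
def wordEval (w : List (V × Bool)) : RAAG Γ :=
  (w.map fun a => if a.2 then gen Γ a.1 else (gen Γ a.1)⁻¹).prod

/-- A word is reduced if every word representing the same element is at least as long. -/
def IsReducedWord (w : List (V × Bool)) : Prop :=
  ∀ w' : List (V × Bool), wordEval Γ w' = wordEval Γ w → w.length ≤ w'.length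

variable {Γ}

/-- The support of an element `g` of `A(Γ)`: the vertices `v` such that `v` or `v⁻¹` occurs in a
reduced word representing `g`. (It is well known that all reduced words representing `g`
involve the same vertices.) -/
def supp (g : RAAG Γ) : Set V :=
  {v | ∃ w : List (V × Bool), IsReducedWord Γ w ∧ wordEval Γ w = g ∧ ∃ b : Bool, (v, b) ∈ w}

variable {W : Type*} {Λ : SimpleGraph W}

/-- The support of a homomorphism `ψ : A(Λ) → A(Γ)`: the union of the supports of the images of
the vertices of `Λ`. -/
def suppHom (ψ : RAAG Λ →* RAAG Γ) : Set V := ⋃ v : W, supp (ψ (gen Λ v))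

/-- Condition (KK): the support of the image of every vertex spans a clique. -/
def SatisfiesKK (ψ : RAAG Λ →* RAAG Γ) : Prop :=
  ∀ v : W, Γ.IsClique (supp (ψ (gen Λ v)))

end RAAG

/-! Let `v 0, …, v (n - 1)` be the vertices in path order. Their left-normed commutator is
nontrivial in `A(P_nᶜ)`: a unitriangular representation sends it to `1 + E 0 n`
(`iteratedCommutator_gen_ne_one`). By injectivity the commutator of the `ψ (v k)` is nontrivial too.
The supports `S k` are cliques, and for non-consecutive indices their vertices are equal or adjacent
(`eq_or_adj_of_commute`). So at each stage the part of `ψ (v k)` not reached by a walk in `Γᶜ`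
through `S 0, S 1, …` commutes with the commutator built so far and drops out. Nontriviality thus
forces a walk through all the `S k` (`iteratedCommutator_mem_closure_reachable`). Consecutive
vertices of it are non-adjacent, the others equal or adjacent; for `n ≠ 3` repetitions are
impossible, so the walk is the full embedding. -/

open scoped commutatorElement

/-! ### Commutators and commuting subgroups -/

/-- The left-normed iterated commutator `[[[f 0, f 1], f 2], …, f k]`. -/
def iteratedCommutator {G : Type*} [Group G] (f : ℕ → G) : ℕ → G
  | 0 => f 0
  | k + 1 => ⁅iteratedCommutator f k, f (k + 1)⁆

theorem map_iteratedCommutator {G H : Type*} [Group G] [Group H] (φ : G →* H) (f : ℕ → G)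
    (k : ℕ) : φ (iteratedCommutator f k) = iteratedCommutator (fun i => φ (f i)) k := by
  induction k with
  | zero => rfl
  | succ k ih => simp only [iteratedCommutator, map_commutatorElement, ih]

/-- A right factor commuting with the first entry can be dropped from a commutator. -/
theorem commutatorElement_mul_right_of_commute {G : Type*} [Group G] {c p q : G}
    (hc : Commute c q) : ⁅c, p * q⁆ = ⁅c, p⁆ := by
  have h : q * c⁻¹ * q⁻¹ = c⁻¹ := by
    rw [(hc.inv_left.eq).symm]; group
  calc ⁅c, p * q⁆ = c * p * (q * c⁻¹ * q⁻¹) * p⁻¹ := by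
        rw [commutatorElement_def]; group
    _ = ⁅c, p⁆ := by rw [h, commutatorElement_def]

/-- If two sets commute elementwise, then so do the subgroups they generate. -/
theorem Subgroup.commute_of_mem_closure {G : Type*} [Group G] {s t : Set G}
    (h : ∀ a ∈ s, ∀ b ∈ t, Commute a b) {x y : G} (hx : x ∈ Subgroup.closure s)
    (hy : y ∈ Subgroup.closure t) : Commute x y := by
  induction hx using Subgroup.closure_induction with
  | mem a ha =>
    induction hy using Subgroup.closure_induction with
    | mem b hb => exact h a ha b hb
    | one => exact Commute.one_right a
    | mul b c _ _ hb hc => exact hb.mul_right hc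
    | inv b _ hb => exact hb.inv_right
  | one => exact Commute.one_left y
  | mul b c _ _ hb hc => exact hb.mul_left hc
  | inv b _ hb => exact hb.inv_left

/-- An element of the subgroup generated by two commuting sets splits as a product. -/
theorem Subgroup.exists_mul_of_mem_closure_union {G : Type*} [Group G] {s t : Set G}
    (h : ∀ a ∈ s, ∀ b ∈ t, Commute a b) {x : G} (hx : x ∈ Subgroup.closure (s ∪ t)) :
    ∃ p ∈ Subgroup.closure s, ∃ q ∈ Subgroup.closure t, x = p * q := by
  induction hx using Subgroup.closure_induction with
  | mem a ha =>
    rcases ha with ha | ha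
    · exact ⟨a, Subgroup.subset_closure ha, 1, one_mem _, (mul_one a).symm⟩
    · exact ⟨1, one_mem _, a, Subgroup.subset_closure ha, (one_mul a).symm⟩
  | one => exact ⟨1, one_mem _, 1, one_mem _, (mul_one 1).symm⟩
  | mul b c _ _ hb hc =>
    obtain ⟨p, hp, q, hq, rfl⟩ := hb
    obtain ⟨p', hp', q', hq', rfl⟩ := hc
    refine ⟨p * p', mul_mem hp hp', q * q', mul_mem hq hq', ?_⟩
    have := (Subgroup.commute_of_mem_closure h hp' hq).eq
    rw [mul_assoc p q, ← mul_assoc q, ← this]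
    simp only [mul_assoc]
  | inv b _ hb =>
    obtain ⟨p, hp, q, hq, rfl⟩ := hb
    refine ⟨p⁻¹, inv_mem hp, q⁻¹, inv_mem hq, ?_⟩
    rw [(Subgroup.commute_of_mem_closure h hp hq).eq, mul_inv_rev]

/-! ### Elementary integer matrices -/

namespace Matrix

variable {m : Type*} [Fintype m] [DecidableEq m]

/-- The elementary matrix `1 + E i j` as an invertible integer matrix. -/
def elementaryUnit (i j : m) (h : i ≠ j) : (Matrix m m ℤ)ˣ where
  val := 1 + single i j 1
  inv := 1 - single i j 1
  val_inv := by
    simp [mul_sub, add_mul, single_mul_single_of_ne _ _ _ _ h.symm]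
  inv_val := by
    simp [mul_add, sub_mul, single_mul_single_of_ne _ _ _ _ h.symm]

theorem elementaryUnit_ne_one (i j : m) (h : i ≠ j) : elementaryUnit i j h ≠ 1 := by
  intro H
  have := congrArg (fun M : (Matrix m m ℤ)ˣ => (M : Matrix m m ℤ) i j) H
  simp [elementaryUnit, h] at this

theorem commute_elementaryUnit {i j k l : m} (h : i ≠ j) (h' : k ≠ l) (hjk : j ≠ k)
    (hli : l ≠ i) : Commute (elementaryUnit i j h) (elementaryUnit k l h') := by
  apply Units.ext
  simp only [elementaryUnit, Units.val_mul, mul_add, add_mul, mul_one, one_mul,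
    single_mul_single_of_ne _ _ _ _ hjk, single_mul_single_of_ne _ _ _ _ hli]
  abel

/-- The only surviving product of matrix units is `E i j * E j k = E i k`; this makes commutators
along the superdiagonal telescope. -/
theorem commutator_elementaryUnit {i j k : m} (hij : i ≠ j) (hjk : j ≠ k) (hik : i ≠ k) :
    ⁅elementaryUnit i j hij, elementaryUnit j k hjk⁆ = elementaryUnit i k hik := by
  rw [commutatorElement_def, mul_inv_eq_iff_eq_mul, mul_inv_eq_iff_eq_mul]
  apply Units.ext
  simp only [elementaryUnit, Units.val_mul, mul_add, add_mul, mul_one, one_mul,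
    single_mul_single_same, single_mul_single_of_ne _ _ _ _ hjk.symm,
    single_mul_single_of_ne _ _ _ _ hik.symm, add_zero]
  abel

end Matrix

/-! ### Supports and commutation in right-angled Artin groups -/

namespace RAAG

section General

variable {V : Type*} {Γ : SimpleGraph V}

theorem commute_gen {u v : V} (h : u = v ∨ Γ.Adj u v) : Commute (gen Γ u) (gen Γ v) := by
  rcases h with rfl | h
  · exact Commute.refl _
  have : (PresentedGroup.mk (raagRelators Γ))
      (FreeGroup.of u * FreeGroup.of v * (FreeGroup.of u)⁻¹ * (FreeGroup.of v)⁻¹) = 1 :=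
    PresentedGroup.one_of_mem ⟨u, v, h, rfl⟩
  simp only [map_mul, map_inv] at this
  rw [mul_inv_eq_one, mul_inv_eq_iff_eq_mul] at this
  exact this

/-- The homomorphism out of `A(Γ)` given by images of the vertices that commute along edges. -/
def lift {G : Type*} [Group G] (f : V → G) (hf : ∀ u v, Γ.Adj u v → Commute (f u) (f v)) :
    RAAG Γ →* G :=
  PresentedGroup.toGroup (f := f) (by
    rintro _ ⟨u, v, h, rfl⟩
    simp only [map_mul, map_inv, FreeGroup.lift_apply_of]
    rw [mul_inv_eq_one, mul_inv_eq_iff_eq_mul]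
    exact hf u v h)

theorem lift_gen {G : Type*} [Group G] (f : V → G)
    (hf : ∀ u v, Γ.Adj u v → Commute (f u) (f v)) (v : V) : lift f hf (gen Γ v) = f v :=
  PresentedGroup.toGroup.of _

theorem wordEval_cons (a : V × Bool) (w : List (V × Bool)) :
    wordEval Γ (a :: w) = (if a.2 then gen Γ a.1 else (gen Γ a.1)⁻¹) * wordEval Γ w := by
  simp [wordEval]

theorem exists_wordEval_eq (g : RAAG Γ) : ∃ w, wordEval Γ w = g := by
  classical
  obtain ⟨x, rfl⟩ := PresentedGroup.mk_surjective _ g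
  refine ⟨x.toWord, ?_⟩
  conv_rhs => rw [← FreeGroup.mk_toWord (x := x)]
  induction x.toWord with
  | nil => rfl
  | cons a w ih =>
    rw [wordEval_cons, ih, ← List.singleton_append, ← FreeGroup.mul_mk, map_mul]
    congr 1
    rcases a with ⟨v, _ | _⟩
    · change (PresentedGroup.mk (raagRelators Γ) (FreeGroup.of v))⁻¹ = _
      rw [← map_inv]
      rfl
    · rfl

theorem exists_isReducedWord (g : RAAG Γ) : ∃ w, IsReducedWord Γ w ∧ wordEval Γ w = g := by
  obtain ⟨w, hw, hmin⟩ := (measure (List.length (α := V × Bool))).wf.has_min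
    {w | wordEval Γ w = g} (exists_wordEval_eq g)
  exact ⟨w, fun w' h => not_lt.mp (hmin w' (h.trans hw)), hw⟩

theorem wordEval_mem_closure {S : Set V} {w : List (V × Bool)} (h : ∀ a ∈ w, a.1 ∈ S) :
    wordEval Γ w ∈ Subgroup.closure (gen Γ '' S) := by
  refine Subgroup.list_prod_mem _ fun x hx => ?_
  obtain ⟨a, ha, rfl⟩ := List.mem_map.mp hx
  have : gen Γ a.1 ∈ Subgroup.closure (gen Γ '' S) :=
    Subgroup.subset_closure ⟨a.1, h a ha, rfl⟩
  split_ifs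
  exacts [this, inv_mem this]

theorem mem_closure_supp (g : RAAG Γ) : g ∈ Subgroup.closure (gen Γ '' supp g) := by
  obtain ⟨w, hw, rfl⟩ := exists_isReducedWord g
  exact wordEval_mem_closure fun a ha => ⟨w, hw, rfl, a.2, ha⟩

open Classical in
/-- If all letters of a word commute with `u`, then the letters `u` and `u⁻¹` can be collected. -/
theorem exists_wordEval_eq_filter_mul_zpow (u : V) (w : List (V × Bool))
    (h : ∀ a ∈ w, a.1 = u ∨ Γ.Adj a.1 u) :
    ∃ e : ℤ, wordEval Γ w = wordEval Γ (w.filter fun a => a.1 ≠ u) * gen Γ u ^ e := by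
  induction w with
  | nil => exact ⟨0, by simp⟩
  | cons a w ih =>
    obtain ⟨e, he⟩ := ih fun b hb => h b (List.mem_cons_of_mem _ hb)
    by_cases hau : a.1 = u
    · have hc : Commute (gen Γ u) (wordEval Γ (w.filter fun a => a.1 ≠ u)) := by
        refine Subgroup.commute_of_mem_closure (s := {gen Γ u})
          (t := gen Γ '' {x | x = u ∨ Γ.Adj x u}) ?_ (Subgroup.subset_closure rfl) (wordEval_mem_closure fun b hb => ?_)
        · rintro _ rfl _ ⟨x, hx, rfl⟩
          exact (commute_gen hx).symm
        · exact h b (List.mem_cons_of_mem _ (List.mem_of_mem_filter hb))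
      rw [wordEval_cons, he, List.filter_cons_of_neg (by simpa using hau), hau]
      rcases a.2 with _ | _
      · refine ⟨-1 + e, ?_⟩
        simp only [Bool.false_eq_true, if_false]
        rw [← mul_assoc, hc.inv_left.eq, zpow_add, zpow_neg_one, mul_assoc]
      · refine ⟨1 + e, ?_⟩
        simp only [if_true]
        rw [← mul_assoc, hc.eq, zpow_add, zpow_one, mul_assoc]
    · refine ⟨e, ?_⟩
      rw [wordEval_cons, he, List.filter_cons_of_pos (by simpa using hau), wordEval_cons,
        mul_assoc]

/-- An element whose support is a clique containing `u` is a nonzero power of `u` times an element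
supported on the rest of the clique. -/
theorem exists_mul_zpow_of_isClique_supp {g : RAAG Γ} (hg : Γ.IsClique (supp g)) {u : V}
    (hu : u ∈ supp g) :
    ∃ e : ℤ, e ≠ 0 ∧ ∃ h ∈ Subgroup.closure (gen Γ '' (supp g \ {u})), g = h * gen Γ u ^ e := by
  classical
  obtain ⟨w, hw, hwg, b, hb⟩ := id hu
  have hsupp : ∀ a ∈ w, a.1 ∈ supp g := fun a ha => ⟨w, hw, hwg, a.2, ha⟩
  obtain ⟨e, he⟩ := exists_wordEval_eq_filter_mul_zpow (Γ := Γ) u w fun a ha =>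
    or_iff_not_imp_left.mpr fun hne => hg (hsupp a ha) hu hne
  refine ⟨e, ?_, _, wordEval_mem_closure fun a ha => ?_, hwg.symm.trans he⟩
  -- With exponent zero, deleting the letters `u` and `u⁻¹` would shorten a reduced word.
  · rintro rfl
    rw [zpow_zero, mul_one] at he
    refine absurd (hw _ he.symm) (not_le.mpr ?_)
    exact List.length_filter_lt_length_iff_exists.mpr ⟨(u, b), hb, by simp⟩
  · rw [List.mem_filter] at ha
    exact ⟨hsupp a ha.1, by simpa using ha.2⟩

/-- Nonzero powers of a translation and of a dilation of the rational line do not commute. -/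
theorem not_commute_translation_dilation {a b : ℤ} (ha : a ≠ 0) (hb : b ≠ 0) :
    ¬ Commute ((Equiv.addRight (1 : ℚ)) ^ a) ((Equiv.mulLeft₀ (2 : ℚ) two_ne_zero) ^ b) := by
  intro h
  have ht : ∀ (a : ℤ) (t : ℚ), ((Equiv.addRight (1 : ℚ)) ^ a) t = t + a := by
    intro a
    induction a using Int.induction_on with
    | zero => simp
    | succ k ih =>
      intro t
      rw [zpow_add_one, Equiv.Perm.mul_apply, ih, Equiv.coe_addRight]
      push_cast
      ring
    | pred k ih =>
      intro t
      rw [zpow_sub_one, Equiv.Perm.mul_apply, ih, Equiv.Perm.inv_def, Equiv.addRight_symm,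
        Equiv.coe_addRight]
      push_cast
      ring
  have hd : ∀ (b : ℤ) (t : ℚ), ((Equiv.mulLeft₀ (2 : ℚ) two_ne_zero) ^ b) t = 2 ^ b * t := by
    intro b
    induction b using Int.induction_on with
    | zero => simp
    | succ k ih =>
      intro t
      rw [zpow_add_one, Equiv.Perm.mul_apply, ih, Equiv.mulLeft₀_apply, zpow_add_one₀ two_ne_zero,
        mul_assoc]
    | pred k ih =>
      intro t
      rw [zpow_sub_one, Equiv.Perm.mul_apply, ih, Equiv.Perm.inv_def,
        Equiv.mulLeft₀_symm_apply, zpow_sub_one₀ two_ne_zero, mul_assoc]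
  -- The dilation fixes `0`, so evaluating there gives `a = 2 ^ b * a`.
  have h0 := congrArg (fun σ : Equiv.Perm ℚ => σ 0) h.eq
  simp only [Equiv.Perm.mul_apply, hd, ht, mul_zero, zero_add] at h0
  have h1 : (2 : ℚ) ^ b = 1 :=
    mul_right_cancel₀ (Int.cast_ne_zero.mpr ha) (h0.symm.trans (one_mul _).symm)
  exact hb ((zpow_eq_one_iff_right₀ zero_le_two (by norm_num)).mp h1)

/-- If two commuting elements of `A(Γ)` are supported on cliques, then vertices of one support are
equal or adjacent to those of the other. -/
theorem eq_or_adj_of_commute {g h : RAAG Γ} (hg : Γ.IsClique (supp g)) (hh : Γ.IsClique (supp h))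
    (hgh : Commute g h) {u w : V} (hu : u ∈ supp g) (hw : w ∈ supp h) : u = w ∨ Γ.Adj u w := by
  classical
  by_contra! hcon
  obtain ⟨huw, hadj⟩ := hcon
  let x : Equiv.Perm ℚ := Equiv.addRight (1 : ℚ)
  let y : Equiv.Perm ℚ := Equiv.mulLeft₀ (2 : ℚ) two_ne_zero
  -- Since `u` and `w` are distinct and non-adjacent, this respects the relations. Neither clique
  -- contains both of them, so `g` and `h` map to nonzero powers of `x` and `y`.
  let f : V → Equiv.Perm ℚ := fun v => if v = u then x else if v = w then y else 1
  have hf : ∀ p q, Γ.Adj p q → Commute (f p) (f q) := by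
    intro p q hpq
    by_cases hpu : p = u
    · have hqu : q ≠ u := fun h => hpq.ne (hpu.trans h.symm)
      have hqw : q ≠ w := by rintro rfl; exact hadj (hpu ▸ hpq)
      simp [f, hqu, hqw]
    · by_cases hpw : p = w
      · have hqu : q ≠ u := by rintro rfl; exact hadj (hpw ▸ hpq.symm)
        have hqw : q ≠ w := fun h => hpq.ne (hpw.trans h.symm)
        simp [f, hqu, hqw]
      · simp [f, hpu, hpw]
  have hker : ∀ {S : Set V} {k : RAAG Γ}, k ∈ Subgroup.closure (gen Γ '' S) → u ∉ S → w ∉ S →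
      lift f hf k = 1 := by
    intro S k hk huS hwS
    have : Subgroup.closure (gen Γ '' S) ≤ (lift f hf).ker := by
      rw [Subgroup.closure_le]
      rintro _ ⟨v, hv, rfl⟩
      have hvu : v ≠ u := fun h => huS (h ▸ hv)
      have hvw : v ≠ w := fun h => hwS (h ▸ hv)
      simp [MonoidHom.mem_ker, lift_gen, f, hvu, hvw]
    exact this hk
  obtain ⟨a, ha, g', hg', hga⟩ := exists_mul_zpow_of_isClique_supp hg hu
  obtain ⟨b, hb, h', hh', hhb⟩ := exists_mul_zpow_of_isClique_supp hh hw
  have hgx : lift f hf g = x ^ a := by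
    rw [hga, map_mul, hker hg' (by simp) (fun h => hadj (hg hu h.1 huw)), map_zpow, lift_gen]
    simp [f]
  have hhy : lift f hf h = y ^ b := by
    rw [hhb, map_mul, hker hh' (fun h => hadj (hh h.1 hw huw)) (by simp), map_zpow, lift_gen]
    simp [f, huw.symm]
  exact not_commute_translation_dilation ha hb (by simpa only [hgx, hhy] using hgh.map (lift f hf))

end General

/-! ### Walks in the complement and iterated commutators -/

section Walk

variable {V : Type*}

/-- The vertices reachable at step `k` by a walk `x 0, x 1, …` in the complement of `Γ` with
`x i ∈ S i` for all `i`. -/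
def reachable (Γ : SimpleGraph V) (S : ℕ → Set V) : ℕ → Set V
  | 0 => S 0
  | k + 1 => {x | x ∈ S (k + 1) ∧ ∃ y ∈ reachable Γ S k, Γᶜ.Adj y x}

variable {Γ : SimpleGraph V} {S : ℕ → Set V}

theorem reachable_subset (k : ℕ) : reachable Γ S k ⊆ S k := by
  cases k with
  | zero => exact subset_rfl
  | succ k => exact fun x hx => hx.1

theorem exists_walk_of_mem_reachable {k : ℕ} {x : V} (hx : x ∈ reachable Γ S k) :
    ∃ f : ℕ → V, f k = x ∧ (∀ j ≤ k, f j ∈ S j) ∧ ∀ j < k, Γᶜ.Adj (f j) (f (j + 1)) := by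
  induction k generalizing x with
  | zero =>
    refine ⟨fun _ => x, rfl, fun j hj => ?_, fun j hj => absurd hj (Nat.not_lt_zero j)⟩
    rw [Nat.le_zero.mp hj]
    exact hx
  | succ k ih =>
    obtain ⟨hxS, y, hy, hyx⟩ := hx
    obtain ⟨f, rfl, hfS, hf⟩ := ih hy
    refine ⟨Function.update f (k + 1) x, by simp, fun j hj => ?_, fun j hj => ?_⟩
    · rcases hj.eq_or_lt with rfl | hj
      · simpa using hxS
      · rw [Function.update_of_ne hj.ne]
        exact hfS j (Nat.lt_succ_iff.mp hj)
    · rw [Function.update_of_ne hj.ne]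
      rcases (Nat.lt_succ_iff.mp hj).eq_or_lt with rfl | hj
      · simpa using hyx
      · rw [Function.update_of_ne (by omega)]
        exact hf j hj

/-- The iterated commutator of elements supported on cliques, where elements of non-consecutive
indices have commuting supports, only involves vertices reachable by walks, and it is trivial if
no vertex is reachable at the last step. -/
theorem iteratedCommutator_mem_closure_reachable {g : ℕ → RAAG Γ} {N : ℕ}
    (hg : ∀ k ≤ N, g k ∈ Subgroup.closure (gen Γ '' S k))
    (hclique : ∀ k ≤ N, Γ.IsClique (S k))
    (hS : ∀ i j, i + 2 ≤ j → j ≤ N → ∀ u ∈ S i, ∀ w ∈ S j, u = w ∨ Γ.Adj u w)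
    {k : ℕ} (hk : k ≤ N) :
    iteratedCommutator g k ∈ Subgroup.closure (gen Γ '' ⋃ j ≤ k, reachable Γ S j) ∧
      (reachable Γ S k = ∅ → iteratedCommutator g k = 1) := by
  induction k with
  | zero =>
    refine ⟨Subgroup.closure_mono (Set.image_mono ?_) (hg 0 hk), fun h => ?_⟩
    · exact Set.subset_iUnion₂_of_subset 0 le_rfl subset_rfl
    · have h0 := hg 0 hk
      rw [show S 0 = ∅ from h, Set.image_empty, Subgroup.closure_empty] at h0
      exact Subgroup.mem_bot.mp h0
  | succ k ih =>
    obtain ⟨hmem, -⟩ := ih (by omega)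
    have hsplit : gen Γ '' S (k + 1) =
        gen Γ '' reachable Γ S (k + 1) ∪ gen Γ '' (S (k + 1) \ reachable Γ S (k + 1)) := by
      rw [← Set.image_union, Set.union_sdiff_cancel (reachable_subset (k + 1))]
    have hcomm : ∀ a ∈ gen Γ '' reachable Γ S (k + 1),
        ∀ b ∈ gen Γ '' (S (k + 1) \ reachable Γ S (k + 1)), Commute a b := by
      rintro _ ⟨u, hu, rfl⟩ _ ⟨w, hw, rfl⟩
      exact commute_gen (or_iff_not_imp_left.mpr
        (hclique (k + 1) hk (reachable_subset (k + 1) hu) hw.1))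
    -- `p` is the reachable part of `g (k + 1)`, `q` the unreachable part.
    obtain ⟨p, hp, q, hq, hpq⟩ := Subgroup.exists_mul_of_mem_closure_union hcomm
      (hsplit ▸ hg (k + 1) hk)
    have hcq : Commute (iteratedCommutator g k) q := by
      refine Subgroup.commute_of_mem_closure ?_ hmem hq
      rintro _ ⟨u, hu, rfl⟩ _ ⟨w, ⟨hwS, hw⟩, rfl⟩
      obtain ⟨j, hj, huj⟩ := Set.mem_iUnion₂.mp hu
      apply commute_gen
      -- For `j = k`, failure to commute would make `w` reachable; for `j < k`, the indices `j` and
      -- `k + 1` are non-consecutive.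
      rcases hj.eq_or_lt with rfl | hj
      · by_contra! hcon
        exact hw ⟨hwS, u, huj, (SimpleGraph.compl_adj ..).mpr hcon⟩
      · exact hS j (k + 1) (by omega) hk u (reachable_subset j huj) w hwS
    have heq : iteratedCommutator g (k + 1) = ⁅iteratedCommutator g k, p⁆ := by
      rw [iteratedCommutator, hpq, commutatorElement_mul_right_of_commute hcq]
    rw [heq]
    refine ⟨?_, fun h => ?_⟩
    · have hc : iteratedCommutator g k ∈
          Subgroup.closure (gen Γ '' ⋃ j ≤ k + 1, reachable Γ S j) :=
        Subgroup.closure_mono (Set.image_mono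
          (Set.biUnion_subset_biUnion_left fun j (hj : j ≤ k) => hj.trans k.le_succ)) hmem
      have hp' : p ∈ Subgroup.closure (gen Γ '' ⋃ j ≤ k + 1, reachable Γ S j) :=
        Subgroup.closure_mono (Set.image_mono
          (Set.subset_biUnion_of_mem (u := reachable Γ S) (Set.mem_Iic.mpr le_rfl))) hp
      rw [commutatorElement_def]
      exact mul_mem (mul_mem (mul_mem hc hp') (inv_mem hc)) (inv_mem hp')
    · rw [h, Set.image_empty, Subgroup.closure_empty, Subgroup.mem_bot] at hp
      rw [hp, commutatorElement_one_right]

end Walk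

/-! ### Nontriviality of the iterated commutator -/

/-- The representation of `A(P_nᶜ)` by unitriangular integer matrices that sends the `i`-th vertex
to `1 + E i (i + 1)`. -/
def unitriangularRep (n : ℕ) :
    RAAG (SimpleGraph.pathGraph n)ᶜ →* (Matrix (Fin (n + 1)) (Fin (n + 1)) ℤ)ˣ :=
  lift (fun i => Matrix.elementaryUnit i.castSucc i.succ i.castSucc_lt_succ.ne) (by
    intro i j hij
    rw [SimpleGraph.compl_adj, SimpleGraph.pathGraph_adj] at hij
    apply Matrix.commute_elementaryUnit
    · intro h
      have := congrArg Fin.val h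
      simp only [Fin.val_succ, Fin.val_castSucc] at this
      omega
    · intro h
      have := congrArg Fin.val h
      simp only [Fin.val_succ, Fin.val_castSucc] at this
      omega)

theorem iteratedCommutator_gen_ne_one {n : ℕ} {v : ℕ → Fin n} (hv : ∀ k < n, (v k : ℕ) = k)
    {k : ℕ} (hk : k < n) :
    iteratedCommutator (fun i => gen (SimpleGraph.pathGraph n)ᶜ (v i)) k ≠ 1 := by
  have key : ∀ k (hk : k < n),
      iteratedCommutator (fun i => unitriangularRep n (gen _ (v i))) k =
        Matrix.elementaryUnit 0 (v k).succ (Fin.succ_ne_zero _).symm := by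
    intro k hk
    induction k with
    | zero =>
      have h0 : (v 0).castSucc = 0 := Fin.ext (hv 0 hk)
      simp only [iteratedCommutator, unitriangularRep, lift_gen, h0]
    | succ k ih =>
      have h1 : (v (k + 1)).castSucc = (v k).succ := by
        apply Fin.ext
        simp [hv k (by omega), hv (k + 1) hk]
      rw [iteratedCommutator, ih (by omega)]
      simp only [unitriangularRep, lift_gen, h1]
      exact Matrix.commutator_elementaryUnit _ _ _
  intro h
  have := congrArg (unitriangularRep n) h
  rw [map_iteratedCommutator, key k hk, map_one] at this
  exact Matrix.elementaryUnit_ne_one _ _ _ this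

end RAAG

/-! ### The full embedding -/

theorem lemma4p2 {V : Type*} [Finite V] (Γ : SimpleGraph V) (n : ℕ) (hn : 0 < n) (hn3 : n ≠ 3)
    (ψ : RAAG (SimpleGraph.pathGraph n)ᶜ →* RAAG Γ) (hψ : Function.Injective ψ)
    (hKK : RAAG.SatisfiesKK ψ) :
    ∃ ι : (SimpleGraph.pathGraph n)ᶜ ↪g Γ,
      (∀ v : Fin n, ι v ∈ RAAG.supp (ψ (RAAG.gen (SimpleGraph.pathGraph n)ᶜ v))) ∧
      Set.range ι ⊆ RAAG.suppHom ψ := by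
  -- Reduction mod `n` only makes `v` total; indices `k ≥ n` play no role.
  let v : ℕ → Fin n := fun k => ⟨k % n, Nat.mod_lt k hn⟩
  have hv : ∀ k < n, (v k : ℕ) = k := fun k hk => Nat.mod_eq_of_lt hk
  let S : ℕ → Set V := fun k => RAAG.supp (ψ (RAAG.gen _ (v k)))
  have hS : ∀ i j, i + 2 ≤ j → j ≤ n - 1 → ∀ u ∈ S i, ∀ w ∈ S j, u = w ∨ Γ.Adj u w := by
    intro i j hij hj u hu w hw
    refine RAAG.eq_or_adj_of_commute (hKK _) (hKK _) ((RAAG.commute_gen (Or.inr ?_)).map ψ) hu hw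
    rw [SimpleGraph.compl_adj, SimpleGraph.pathGraph_adj, Ne, Fin.ext_iff, hv i (by omega),
      hv j (by omega)]
    omega
  have hne : RAAG.reachable Γ S (n - 1) ≠ ∅ := by
    intro h
    have h1 := (RAAG.iteratedCommutator_mem_closure_reachable
      (g := fun k => ψ (RAAG.gen _ (v k))) (fun k _ => RAAG.mem_closure_supp _)
      (fun k _ => hKK _) hS le_rfl).2 h
    rw [← map_iteratedCommutator ψ (fun k => RAAG.gen _ (v k))] at h1
    exact RAAG.iteratedCommutator_gen_ne_one hv (show n - 1 < n by omega)
      (hψ (h1.trans (map_one ψ).symm))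
  obtain ⟨x, hx⟩ := Set.nonempty_iff_ne_empty.mpr hne
  obtain ⟨f, -, hfS, hf⟩ := RAAG.exists_walk_of_mem_reachable hx
  -- A repeated vertex would have a non-adjacent neighbour on the walk at distance at least two
  -- from one of its two occurrences.
  have hinj : ∀ i j, i < j → j < n → f i ≠ f j := by
    intro i j hij hj heq
    obtain rfl | hij2 := (Nat.succ_le_of_lt hij).eq_or_lt
    · exact (hf i (by omega)).ne heq
    rcases Nat.eq_zero_or_pos i with rfl | hi
    · rcases (show j ≤ n - 1 by omega).eq_or_lt with hjn | hjn
      -- The repetition joins the two ends of the walk, so the neighbour used is `f 1`. Here `1` and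
      -- `j = n - 1` differ by at least two because `n ≠ 3`.
      · have h := hf 0 (by omega)
        rw [heq, zero_add, SimpleGraph.compl_adj] at h
        rcases hS 1 j (by omega) (by omega) _ (hfS 1 (by omega)) _ (hfS j (by omega)) with h' | h'
        · exact h.1 h'.symm
        · exact h.2 h'.symm
      · have h := hf j hjn
        rw [← heq, SimpleGraph.compl_adj] at h
        rcases hS 0 (j + 1) (by omega) (by omega) _ (hfS 0 (by omega)) _ (hfS (j + 1) (by omega))
          with h' | h'
        · exact h.1 h'
        · exact h.2 h'
    · have h := hf (i - 1) (by omega)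
      rw [Nat.sub_add_cancel hi, heq, SimpleGraph.compl_adj] at h
      rcases hS (i - 1) j (by omega) (by omega) _ (hfS (i - 1) (by omega)) _ (hfS j (by omega))
        with h' | h'
      · exact h.1 h'
      · exact h.2 h'
  have hadj : ∀ i j, i < j → j < n → (Γ.Adj (f i) (f j) ↔ i + 1 ≠ j) := by
    intro i j hij hj
    constructor
    · rintro h rfl
      exact ((SimpleGraph.compl_adj ..).mp (hf i (by omega))).2 h
    · intro h
      exact (hS i j (by omega) (by omega) _ (hfS i (by omega)) _ (hfS j (by omega))).resolve_left
        (hinj i j hij hj)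
  have hmem : ∀ i : Fin n, f i ∈ RAAG.supp (ψ (RAAG.gen (SimpleGraph.pathGraph n)ᶜ i)) := by
    intro i
    have h := hfS i (by omega)
    rwa [show S i = RAAG.supp (ψ (RAAG.gen _ (v i))) from rfl,
      show v i = i from Fin.ext (hv i i.isLt)] at h
  refine ⟨⟨⟨fun i => f i, fun i j hij => ?_⟩, fun {i j} => ?_⟩, hmem, ?_⟩
  · by_contra hne
    rcases lt_or_gt_of_ne (Fin.val_ne_of_ne hne) with h | h
    · exact hinj i j h j.isLt hij
    · exact hinj j i h i.isLt hij.symm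
  · change Γ.Adj (f i) (f j) ↔ _
    rw [SimpleGraph.compl_adj, SimpleGraph.pathGraph_adj, Ne, Fin.ext_iff]
    rcases lt_trichotomy (i : ℕ) j with h | h | h
    · rw [hadj i j h j.isLt]
      omega
    · simp [h]
    · rw [Γ.adj_comm, hadj j i h i.isLt]
      omega
  · rintro _ ⟨i, rfl⟩
    exact Set.mem_iUnion.mpr ⟨i, hmem i⟩
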